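/- Let $\alpha=(\alpha_1,\dots,\alpha_\ell)$ be a composition of a positive integer $n$, with composition diagram having $\alpha_i$ left-justified boxes in row $i$ from the top, and let $\sigma\in\mathfrak S_\ell$. A *standard permuted composition tableau* (SPCT) of shape $\alpha$ and type $\sigma$ is a bijective filling $\tau$ of this diagram by $1,\dots,n$ such that: (1) for all rows $i,j$, $\tau(i,1)<\tau(j,1)$ if and only if $\sigma(i)<\sigma(j)$; (2) the entries of each row decrease from left to right; (3) if $i<j$ and $\tau(i,k)>\tau(j,k+1)$, where $(i,k)$ and $(j,k+1)$ are boxes of the diagram, then $(i,k+1)$ is a box of the diagram and $\tau(i,k+1)>\tau(j,k+1)$. Let $\mathrm{SPCT}^\sigma(\alpha)$ be the set of these tableaux. For $1\le i\le n-1$, call $i$ a *descent* of $\tau$ if $i+1$ lies in a column weakly to the right of that of $i$. Call $i$ and $i+1$ *attacking* in $\tau$ if they lie in the same column, or if $i+1$ lies in the column immediately to the right of that of $i$ and in a strictly lower row. Call $\tau$ a *source tableau* if for every $1\le i\le n-1$ that is not a descent of $\tau$, $i+1$ lies in the box immediately to the left of $i$. The $0$-Hecke algebra $H_n(0)$ is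 the $\mathbb C$-algebra generated by $\pi_1,\dots,\pi_{n-1}$ with relations $\pi_i^2=\pi_i$, $\pi_i\pi_{i+1}\pi_i=\pi_{i+1}\pi_i\pi_{i+1}$, and $\pi_i\pi_j=\pi_j\pi_i$ for $|i-j|\ge2$. Let $\mathbf S^\sigma_\alpha$ be the $H_n(0)$-module with $\mathbb C$-basis $\mathrm{SPCT}^\sigma(\alpha)$ on which $\pi_i\cdot\tau=\tau$ if $i$ is not a descent of $\tau$, $\pi_i\cdot\tau=0$ if $i$ is a descent and $i,i+1$ are attacking, and $\pi_i\cdot\tau$ is the tableau obtained from $\tau$ by swapping $i$ and $i+1$ if $i$ is a descent and $i,i+1$ are not attacking. Call $\mathbf S^\sigma_\alpha$ *SPCT-cyclic* if it is generated as an $H_n(0)$-module by a single element $\tau\in\mathrm{SPCT}^\sigma(\alpha)$ (in particular $\mathrm{SPCT}^\sigma(\alpha)\neq\emptyset$). A pair $(i,j)$ with $i<j$ is a *PACD pair* attached to $(\alpha;\sigma)$ if $\sigma(i)<\sigma(j)$ and $\alpha_i\ge\alpha_j\ge2$. Call $\alpha$ *$\sigma$-simple* if $\alpha$ is compatible with $\sigma$,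 that is, $\alpha_i\ge\alpha_j$ whenever $i<j$ and $\sigma(i)>\sigma(j)$, and every PACD pair $(i,j)$ attached to $(\alpha;\sigma)$ satisfies one of the following conditions. - **C1.** There is $k$ with $i<k<j$, $\sigma(i)<\sigma(k)<\sigma(j)$ and $\alpha_k=\alpha_j-1$. - **C2.** There is $k>j$ with $\sigma(i)<\sigma(k)<\sigma(j)$ and $\alpha_k=\alpha_j$. **Theorem.** Let $\alpha$ be a composition of a positive integer $n$. (a) For every $\sigma\in\mathfrak S_\ell$, $\mathrm{SPCT}^\sigma(\alpha)$ contains a unique source tableau if and only if $\alpha$ is $\sigma$-simple. (b) For every $\sigma\in\mathfrak S_\ell$, $\mathbf S^\sigma_\alpha$ is SPCT-cyclic if and only if $\alpha$ is $\sigma$-simple. -/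

import Mathlib

namespace PermComp

/-! ### The 0-Hecke algebra -/

/-- Indices of the generators of the 0-Hecke algebra: `1 ≤ i ≤ n - 1`. -/
abbrev Gen (n : ℕ) : Type := {i : ℕ // 1 ≤ i ∧ i < n}

/-- The defining relations of the 0-Hecke algebra. -/
inductive HeckeRel (n : ℕ) : FreeAlgebra ℂ (Gen n) → FreeAlgebra ℂ (Gen n) → Prop
  | idem (i : Gen n) : HeckeRel n (FreeAlgebra.ι ℂ i * FreeAlgebra.ι ℂ i) (FreeAlgebra.ι ℂ i)
  | braid (i j : Gen n) (h : j.1 = i.1 + 1) :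
      HeckeRel n (FreeAlgebra.ι ℂ i * FreeAlgebra.ι ℂ j * FreeAlgebra.ι ℂ i)
        (FreeAlgebra.ι ℂ j * FreeAlgebra.ι ℂ i * FreeAlgebra.ι ℂ j)
  | comm (i j : Gen n) (h : i.1 + 2 ≤ j.1) :
      HeckeRel n (FreeAlgebra.ι ℂ i * FreeAlgebra.ι ℂ j) (FreeAlgebra.ι ℂ j * FreeAlgebra.ι ℂ i)

/-- The 0-Hecke algebra `H_n(0)` over `ℂ`, by generators and relations. -/
abbrev ZeroHecke (n : ℕ) : Type := RingQuot (HeckeRel n)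

/-- The generator `π_i` of `H_n(0)`. -/
noncomputable def ZeroHecke.pi {n : ℕ} (i : Gen n) : ZeroHecke n :=
  RingQuot.mkAlgHom ℂ (HeckeRel n) (FreeAlgebra.ι ℂ i)

/-! ### Composition diagrams and tableaux -/

/-- The boxes of the composition diagram of `α`: row `i` has `α_i` boxes. Rows and columns are
numbered from `0`, rows from top to bottom and columns from left to right. -/
abbrev Box {n : ℕ} (α : Composition n) : Type := Σ i : Fin α.length, Fin (α.blocksFun i)

/-- The row of a box. -/
def Box.row {n : ℕ} {α : Composition n} (b : Box α) : Fin α.length := b.1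

/-- The column of a box. -/
def Box.col {n : ℕ} {α : Composition n} (b : Box α) : ℕ := b.2.1

/-- The leftmost box of row `i`. -/
def firstBox {n : ℕ} (α : Composition n) (i : Fin α.length) : Box α :=
  ⟨i, ⟨0, α.one_le_blocksFun i⟩⟩

/-- `σ` is the standardization of the word `w` (which has no repeated letters). -/
def IsStandardization {l : ℕ} (w : Fin l → ℕ) (σ : Equiv.Perm (Fin l)) : Prop :=
  Function.Injective w ∧ ∀ i j : Fin l, i < j → (σ j < σ i ↔ w j < w i)

/-- Permuted composition tableaux of shape `α` and type `σ`. -/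
structure IsPCT {n : ℕ} (α : Composition n) (σ : Equiv.Perm (Fin α.length))
    (T : Box α → ℕ) : Prop where
  pos : ∀ x, 0 < T x
  first : IsStandardization (fun i => T (firstBox α i)) σ
  rows : ∀ x y : Box α, x.row = y.row → x.col ≤ y.col → T y ≤ T x
  triple : ∀ x y : Box α, x.row < y.row → y.col = x.col + 1 → T y < T x →
    ∃ z : Box α, z.row = x.row ∧ z.col = y.col ∧ T y < T z

/-- Standard permuted composition tableaux of shape `α` and type `σ`: the entries are distinct and
at most `n`. -/
structure SPCT {n : ℕ} (α : Composition n) (σ : Equiv.Perm (Fin α.length)) : Type where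
  toFun : Box α → ℕ
  isPCT : IsPCT α σ toFun
  inj : Function.Injective toFun
  le : ∀ x, toFun x ≤ n

namespace SPCT

variable {n : ℕ} {α : Composition n} {σ : Equiv.Perm (Fin α.length)}

/-- `i` is a descent: `1 ≤ i ≤ n - 1` and `i + 1` lies weakly right of `i`. -/
def IsDescent (τ : SPCT α σ) (i : ℕ) : Prop :=
  ∃ x y : Box α, τ.toFun x = i ∧ τ.toFun y = i + 1 ∧ x.col ≤ y.col

/-- `i < j` are attacking: they lie in the same column, or in adjacent columns with `j` strictly
lower and to the right of `i`. -/
def Attacking (τ : SPCT α σ) (i j : ℕ) : Prop :=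
  ∃ x y : Box α, τ.toFun x = i ∧ τ.toFun y = j ∧
    (x.col = y.col ∨ (y.col = x.col + 1 ∧ x.row < y.row))

/-- `τ` is a source tableau: whenever `1 ≤ i ≤ n - 1` is not a descent, `i + 1` lies immediately
to the left of `i`. -/
def IsSource (τ : SPCT α σ) : Prop :=
  ∀ i : ℕ, 1 ≤ i → i < n → ¬ τ.IsDescent i →
    ∃ x y : Box α, τ.toFun x = i ∧ τ.toFun y = i + 1 ∧ y.row = x.row ∧ x.col = y.col + 1

theorem ext_fun {τ τ' : SPCT α σ} (h : τ.toFun = τ'.toFun) : τ = τ' := by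
  cases τ; cases τ'; cases h; rfl

theorem exists_box (τ : SPCT α σ) (i : ℕ) (h1 : 1 ≤ i) (hn : i ≤ n) : ∃ x, τ.toFun x = i := by
  have hsub : Finset.univ.image τ.toFun ⊆ Finset.Icc 1 n := by
    intro k hk
    obtain ⟨x, -, rfl⟩ := Finset.mem_image.1 hk
    exact Finset.mem_Icc.2 ⟨τ.isPCT.pos x, τ.le x⟩
  have hcard : (Finset.univ.image τ.toFun).card = n := by
    rw [Finset.card_image_of_injective _ τ.inj, Finset.card_univ, Fintype.card_sigma]
    simp [α.sum_blocksFun]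
  have heq := Finset.eq_of_subset_of_card_le hsub (by rw [hcard]; simp)
  have : i ∈ Finset.univ.image τ.toFun := by rw [heq]; exact Finset.mem_Icc.2 ⟨h1, hn⟩
  obtain ⟨x, -, hx⟩ := Finset.mem_image.1 this
  exact ⟨x, hx⟩

theorem isDescent_iff (τ : SPCT α σ) {i : ℕ} {x y : Box α} (hx : τ.toFun x = i)
    (hy : τ.toFun y = i + 1) : τ.IsDescent i ↔ x.col ≤ y.col := by
  constructor
  · rintro ⟨x', y', hx', hy', h⟩
    rw [τ.inj (hx.trans hx'.symm), τ.inj (hy.trans hy'.symm)]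
    exact h
  · exact fun h => ⟨x, y, hx, hy, h⟩

theorem attacking_iff (τ : SPCT α σ) {i j : ℕ} {x y : Box α} (hx : τ.toFun x = i)
    (hy : τ.toFun y = j) :
    τ.Attacking i j ↔ (x.col = y.col ∨ (y.col = x.col + 1 ∧ x.row < y.row)) := by
  constructor
  · rintro ⟨x', y', hx', hy', h⟩
    rw [τ.inj (hx.trans hx'.symm), τ.inj (hy.trans hy'.symm)]
    exact h
  · exact fun h => ⟨x, y, hx, hy, h⟩

/-- Swapping `i` and `i + 1` only changes the comparison of these two entries. -/
theorem swap_lt_iff (i a b : ℕ) (h : ¬ (a = i ∧ b = i + 1)) (h' : ¬ (a = i + 1 ∧ b = i)) :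
    Equiv.swap i (i + 1) a < Equiv.swap i (i + 1) b ↔ a < b := by
  simp only [Equiv.swap_apply_def]
  split_ifs <;> omega

/-- `s_i · τ`, obtained from `τ` by swapping `i` and `i + 1`, where `i` is a descent such that `i`
and `i + 1` are nonattacking. -/
def swap (τ : SPCT α σ) (i : Gen n) (hd : τ.IsDescent i.1)
    (ha : ¬ τ.Attacking i.1 (i.1 + 1)) : SPCT α σ where
  toFun x := Equiv.swap i.1 (i.1 + 1) (τ.toFun x)
  isPCT := by
    have hcol : ∀ x y : Box α, x.col = y.col →
        (Equiv.swap i.1 (i.1 + 1) (τ.toFun x) < Equiv.swap i.1 (i.1 + 1) (τ.toFun y) ↔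
          τ.toFun x < τ.toFun y) := by
      intro x y h
      apply swap_lt_iff
      · rintro ⟨hx, hy⟩
        exact ha ((τ.attacking_iff hx hy).2 (Or.inl h))
      · rintro ⟨hx, hy⟩
        exact ha ((τ.attacking_iff hy hx).2 (Or.inl h.symm))
    refine ⟨?_, ⟨?_, ?_⟩, ?_, ?_⟩
    · intro x
      have := τ.isPCT.pos x
      have := i.2.1
      simp only [Equiv.swap_apply_def]
      split_ifs <;> omega
    · intro a b h
      exact τ.isPCT.first.1 ((Equiv.swap i.1 (i.1 + 1)).injective h)
    · intro a b hab
      exact (τ.isPCT.first.2 a b hab).trans (hcol (firstBox α b) (firstBox α a) rfl).symm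
    · intro x y hr hc
      rw [← not_lt, swap_lt_iff, not_lt]
      · exact τ.isPCT.rows x y hr hc
      · rintro ⟨hx, hy⟩
        have := τ.isPCT.rows x y hr hc
        omega
      · rintro ⟨hx, hy⟩
        have h1 := (τ.isDescent_iff hy hx).1 hd
        exact ha ((τ.attacking_iff hy hx).2 (Or.inl (by omega)))
    · intro x y hr hc hlt
      rw [swap_lt_iff] at hlt
      · obtain ⟨z, hz1, hz2, hz3⟩ := τ.isPCT.triple x y hr hc hlt
        exact ⟨z, hz1, hz2, (hcol y z hz2.symm).2 hz3⟩
      · rintro ⟨hy, hx⟩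
        have h1 := (τ.isDescent_iff hy hx).1 hd
        omega
      · rintro ⟨hy, hx⟩
        exact ha ((τ.attacking_iff hx hy).2 (Or.inr ⟨hc, hr⟩))
  inj a b h := τ.inj ((Equiv.swap i.1 (i.1 + 1)).injective h)
  le x := by
    have := τ.le x
    have := i.2.2
    simp only [Equiv.swap_apply_def]
    split_ifs <;> omega

open Classical in
/-- The action of the generator `π_i` on a tableau, with values in the `ℂ`-span of all tableaux. -/
noncomputable def act (i : Gen n) (τ : SPCT α σ) : SPCT α σ →₀ ℂ :=
  if hd : τ.IsDescent i.1 then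
    if ha : τ.Attacking i.1 (i.1 + 1) then 0 else Finsupp.single (τ.swap i hd ha) 1
  else Finsupp.single τ 1

/-- The action of `π_i` on the `ℂ`-span of all tableaux, extended linearly. -/
noncomputable def op (i : Gen n) : Module.End ℂ (SPCT α σ →₀ ℂ) :=
  Finsupp.linearCombination ℂ (act i)

theorem op_single (i : Gen n) (τ : SPCT α σ) : op i (Finsupp.single τ 1) = act i τ := by
  simp [op]

/-- The three cases of the action in terms of the boxes of `i` and `i + 1`. -/
theorem op_cases (i : Gen n) (τ : SPCT α σ) {x y : Box α} (hx : τ.toFun x = i.1)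
    (hy : τ.toFun y = i.1 + 1) :
    (y.col < x.col ∧ op i (Finsupp.single τ 1) = Finsupp.single τ 1) ∨
    ((x.col = y.col ∨ (y.col = x.col + 1 ∧ x.row < y.row)) ∧ op i (Finsupp.single τ 1) = 0) ∨
    ((x.col < y.col ∧ ¬ (y.col = x.col + 1 ∧ x.row < y.row)) ∧
      ∃ τ' : SPCT α σ, (τ'.toFun = fun b => Equiv.swap i.1 (i.1 + 1) (τ.toFun b)) ∧
        op i (Finsupp.single τ 1) = Finsupp.single τ' 1) := by
  rw [op_single]
  unfold act
  by_cases hd : τ.IsDescent i.1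
  · by_cases ha : τ.Attacking i.1 (i.1 + 1)
    · right; left
      exact ⟨(τ.attacking_iff hx hy).1 ha, by rw [dif_pos hd, dif_pos ha]⟩
    · right; right
      refine ⟨?_, τ.swap i hd ha, rfl, by rw [dif_pos hd, dif_neg ha]⟩
      have h1 := (τ.isDescent_iff hx hy).1 hd
      rw [τ.attacking_iff hx hy, not_or] at ha
      exact ⟨by omega, ha.2⟩
  · left
    refine ⟨?_, by rw [dif_neg hd]⟩
    rw [τ.isDescent_iff hx hy] at hd
    omega

theorem end_ext {f g : Module.End ℂ (SPCT α σ →₀ ℂ)}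
    (h : ∀ τ, f (Finsupp.single τ 1) = g (Finsupp.single τ 1)) : f = g :=
  Finsupp.lhom_ext' fun τ => LinearMap.ext_ring (h τ)

theorem op_idem (i : Gen n) : (op i * op i : Module.End ℂ (SPCT α σ →₀ ℂ)) = op i := by
  apply end_ext
  intro τ
  obtain ⟨x, hx⟩ := τ.exists_box i.1 i.2.1 i.2.2.le
  obtain ⟨y, hy⟩ := τ.exists_box (i.1 + 1) (by omega) i.2.2
  rw [Module.End.mul_apply]
  rcases op_cases i τ hx hy with ⟨_, h⟩ | ⟨_, h⟩ | ⟨hc, τ', hτ', h⟩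
  · rw [h, h]
  · rw [h, map_zero]
  · rw [h]
    have hx' : τ'.toFun y = i.1 := by simp [hτ', hy]
    have hy' : τ'.toFun x = i.1 + 1 := by simp [hτ', hx]
    rcases op_cases i τ' hx' hy' with ⟨_, h'⟩ | ⟨h1, _⟩ | ⟨h1, _⟩
    · exact h'
    · omega
    · omega

theorem op_comm (i j : Gen n) (hij : i.1 + 2 ≤ j.1) :
    (op i * op j : Module.End ℂ (SPCT α σ →₀ ℂ)) = op j * op i := by
  apply end_ext
  intro τ
  obtain ⟨x, hx⟩ := τ.exists_box i.1 i.2.1 i.2.2.le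
  obtain ⟨y, hy⟩ := τ.exists_box (i.1 + 1) (by omega) i.2.2
  obtain ⟨z, hz⟩ := τ.exists_box j.1 j.2.1 j.2.2.le
  obtain ⟨w, hw⟩ := τ.exists_box (j.1 + 1) (by omega) j.2.2
  simp only [Module.End.mul_apply]
  rcases op_cases i τ hx hy with ⟨c1, h1⟩ | ⟨c1, h1⟩ | ⟨c1, τ1, e1, h1⟩ <;>
  rcases op_cases j τ hz hw with ⟨c2, h2⟩ | ⟨c2, h2⟩ | ⟨c2, τ2, e2, h2⟩ <;>
  simp only [h1, h2, map_zero]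
  · have hx' : τ2.toFun x = i.1 := by
      rw [e2]; simp only [hx]; exact Equiv.swap_apply_of_ne_of_ne (by omega) (by omega)
    have hy' : τ2.toFun y = i.1 + 1 := by
      rw [e2]; simp only [hy]; exact Equiv.swap_apply_of_ne_of_ne (by omega) (by omega)
    rcases op_cases i τ2 hx' hy' with ⟨c3, h3⟩ | ⟨c3, h3⟩ | ⟨c3, τ3, e3, h3⟩
    · exact h3
    · omega
    · omega
  · have hx' : τ2.toFun x = i.1 := by
      rw [e2]; simp only [hx]; exact Equiv.swap_apply_of_ne_of_ne (by omega) (by omega)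
    have hy' : τ2.toFun y = i.1 + 1 := by
      rw [e2]; simp only [hy]; exact Equiv.swap_apply_of_ne_of_ne (by omega) (by omega)
    rcases op_cases i τ2 hx' hy' with ⟨c3, h3⟩ | ⟨c3, h3⟩ | ⟨c3, τ3, e3, h3⟩
    · omega
    · exact h3
    · omega
  · have hz' : τ1.toFun z = j.1 := by
      rw [e1]; simp only [hz]; exact Equiv.swap_apply_of_ne_of_ne (by omega) (by omega)
    have hw' : τ1.toFun w = j.1 + 1 := by
      rw [e1]; simp only [hw]; exact Equiv.swap_apply_of_ne_of_ne (by omega) (by omega)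
    rcases op_cases j τ1 hz' hw' with ⟨c3, h3⟩ | ⟨c3, h3⟩ | ⟨c3, τ3, e3, h3⟩
    · exact h3.symm
    · omega
    · omega
  · have hz' : τ1.toFun z = j.1 := by
      rw [e1]; simp only [hz]; exact Equiv.swap_apply_of_ne_of_ne (by omega) (by omega)
    have hw' : τ1.toFun w = j.1 + 1 := by
      rw [e1]; simp only [hw]; exact Equiv.swap_apply_of_ne_of_ne (by omega) (by omega)
    rcases op_cases j τ1 hz' hw' with ⟨c3, h3⟩ | ⟨c3, h3⟩ | ⟨c3, τ3, e3, h3⟩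
    · omega
    · exact h3.symm
    · omega
  · have hx' : τ2.toFun x = i.1 := by
      rw [e2]; simp only [hx]; exact Equiv.swap_apply_of_ne_of_ne (by omega) (by omega)
    have hy' : τ2.toFun y = i.1 + 1 := by
      rw [e2]; simp only [hy]; exact Equiv.swap_apply_of_ne_of_ne (by omega) (by omega)
    have hz' : τ1.toFun z = j.1 := by
      rw [e1]; simp only [hz]; exact Equiv.swap_apply_of_ne_of_ne (by omega) (by omega)
    have hw' : τ1.toFun w = j.1 + 1 := by
      rw [e1]; simp only [hw]; exact Equiv.swap_apply_of_ne_of_ne (by omega) (by omega)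
    rcases op_cases i τ2 hx' hy' with ⟨c3, h3⟩ | ⟨c3, h3⟩ | ⟨c3, τ3, e3, h3⟩
    · omega
    · omega
    rcases op_cases j τ1 hz' hw' with ⟨c4, h4⟩ | ⟨c4, h4⟩ | ⟨c4, τ4, e4, h4⟩
    · omega
    · omega
    rw [h3, h4]
    congr 1
    apply ext_fun
    rw [e3, e4, e1, e2]
    funext b
    simp only [Equiv.swap_apply_def]
    split_ifs <;> omega

theorem swap_braid (i v : ℕ) :
    Equiv.swap i (i + 1) (Equiv.swap (i + 1) (i + 1 + 1) (Equiv.swap i (i + 1) v)) =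
      Equiv.swap (i + 1) (i + 1 + 1) (Equiv.swap i (i + 1)
        (Equiv.swap (i + 1) (i + 1 + 1) v)) := by
  have e1 : ∀ w, w ≠ i → w ≠ i + 1 → Equiv.swap i (i + 1) w = w :=
    fun w => Equiv.swap_apply_of_ne_of_ne
  have e2 : ∀ w, w ≠ i + 1 → w ≠ i + 1 + 1 → Equiv.swap (i + 1) (i + 1 + 1) w = w :=
    fun w => Equiv.swap_apply_of_ne_of_ne
  by_cases h0 : v = i
  · subst h0
    rw [e2 v (by omega) (by omega), Equiv.swap_apply_left, Equiv.swap_apply_left,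
      e1 _ (by omega) (by omega)]
  by_cases h1 : v = i + 1
  · subst h1
    rw [Equiv.swap_apply_right, e2 i (by omega) (by omega), Equiv.swap_apply_left,
      Equiv.swap_apply_left, e1 (i + 1 + 1) (by omega) (by omega), Equiv.swap_apply_right]
  by_cases h2 : v = i + 1 + 1
  · subst h2
    rw [e1 (i + 1 + 1) (by omega) (by omega), Equiv.swap_apply_right, Equiv.swap_apply_right,
      e2 i (by omega) (by omega)]
  rw [e1 v h0 h1, e2 v h1 h2, e1 v h0 h1, e2 v h1 h2]

theorem op_braid (i j : Gen n) (hij : j.1 = i.1 + 1) :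
    (op i * op j * op i : Module.End ℂ (SPCT α σ →₀ ℂ)) = op j * op i * op j := by
  apply end_ext
  intro τ
  obtain ⟨x, hx⟩ := τ.exists_box i.1 i.2.1 i.2.2.le
  obtain ⟨y, hy⟩ := τ.exists_box j.1 j.2.1 j.2.2.le
  obtain ⟨z, hz⟩ := τ.exists_box (j.1 + 1) (by omega) j.2.2
  simp only [Module.End.mul_apply]
  -- the action on a tableau with `i, i + 1, i + 2` in three given boxes
  have A : ∀ (t : SPCT α σ) (a b c : Box α),
      t.toFun a = i.1 → t.toFun b = j.1 → t.toFun c = j.1 + 1 →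
      (b.col < a.col ∧ op i (Finsupp.single t 1) = Finsupp.single t 1) ∨
      ((a.col = b.col ∨ (b.col = a.col + 1 ∧ a.row.1 < b.row.1)) ∧
        op i (Finsupp.single t 1) = 0) ∨
      ((a.col < b.col ∧ ¬ (b.col = a.col + 1 ∧ a.row.1 < b.row.1)) ∧
        ∃ t' : SPCT α σ, (t'.toFun = fun b => Equiv.swap i.1 (i.1 + 1) (t.toFun b)) ∧
          (t'.toFun b = i.1 ∧ t'.toFun a = j.1 ∧ t'.toFun c = j.1 + 1) ∧
          op i (Finsupp.single t 1) = Finsupp.single t' 1) := by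
    intro t a b c ha hb hc
    rcases op_cases i t ha (hb.trans hij) with h | h | ⟨h, t', e, h'⟩
    · exact Or.inl h
    · exact Or.inr (Or.inl h)
    · refine Or.inr (Or.inr ⟨h, t', e, ?_, h'⟩)
      rw [e]
      simp only [ha, hb, hc, Equiv.swap_apply_def]
      refine ⟨?_, ?_, ?_⟩ <;> split_ifs <;> omega
  have B : ∀ (t : SPCT α σ) (a b c : Box α),
      t.toFun a = i.1 → t.toFun b = j.1 → t.toFun c = j.1 + 1 →
      (c.col < b.col ∧ op j (Finsupp.single t 1) = Finsupp.single t 1) ∨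
      ((b.col = c.col ∨ (c.col = b.col + 1 ∧ b.row.1 < c.row.1)) ∧
        op j (Finsupp.single t 1) = 0) ∨
      ((b.col < c.col ∧ ¬ (c.col = b.col + 1 ∧ b.row.1 < c.row.1)) ∧
        ∃ t' : SPCT α σ, (t'.toFun = fun b => Equiv.swap j.1 (j.1 + 1) (t.toFun b)) ∧
          (t'.toFun a = i.1 ∧ t'.toFun c = j.1 ∧ t'.toFun b = j.1 + 1) ∧
          op j (Finsupp.single t 1) = Finsupp.single t' 1) := by
    intro t a b c ha hb hc
    rcases op_cases j t hb hc with h | h | ⟨h, t', e, h'⟩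
    · exact Or.inl h
    · exact Or.inr (Or.inl h)
    · refine Or.inr (Or.inr ⟨h, t', e, ?_, h'⟩)
      rw [e]
      simp only [ha, hb, hc, Equiv.swap_apply_def]
      refine ⟨?_, ?_, ?_⟩ <;> split_ifs <;> omega
  rcases A τ x y z hx hy hz with ⟨c1, h1⟩ | ⟨c1, h1⟩ | ⟨c1, t1, e1, ⟨p1, q1, r1⟩, h1⟩ <;>
  rcases B τ x y z hx hy hz with ⟨c2, h2⟩ | ⟨c2, h2⟩ | ⟨c2, t2, e2, ⟨p2, q2, r2⟩, h2⟩ <;>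
  simp only [h1, h2, map_zero]
  · -- the case `t2 = (x, z, y)`
    rcases A t2 x z y p2 q2 r2 with ⟨c3, h3⟩ | ⟨c3, h3⟩ | ⟨c3, t3, e3, ⟨p3, q3, r3⟩, h3⟩
    · rw [h3]
      rcases B t2 x z y p2 q2 r2 with ⟨c4, h4⟩ | ⟨c4, h4⟩ | ⟨c4, t4, e4, ⟨p4, q4, r4⟩, h4⟩
      · exact h4.symm
      · omega
      · omega
    · rw [h3, map_zero]
    · rw [h3]
      rcases B t3 z x y p3 q3 r3 with ⟨c4, h4⟩ | ⟨c4, h4⟩ | ⟨c4, t4, e4, ⟨p4, q4, r4⟩, h4⟩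
      · exact h4.symm
      · omega
      · omega
  · -- the case `t2 = (x, z, y)`, where `x`, `y` are attacking
    rcases A t2 x z y p2 q2 r2 with ⟨c3, h3⟩ | ⟨c3, h3⟩ | ⟨c3, t3, e3, ⟨p3, q3, r3⟩, h3⟩
    · omega
    · rw [h3, map_zero]
    · rw [h3]
      rcases B t3 z x y p3 q3 r3 with ⟨c4, h4⟩ | ⟨c4, h4⟩ | ⟨c4, t4, e4, ⟨p4, q4, r4⟩, h4⟩
      · omega
      · exact h4.symm
      · omega
  · -- the case `t1 = (y, x, z)`, where `y`, `z` are not a descent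
    rcases B t1 y x z p1 q1 r1 with ⟨c3, h3⟩ | ⟨c3, h3⟩ | ⟨c3, t3, e3, ⟨p3, q3, r3⟩, h3⟩
    · rw [h3]
      rcases A t1 y x z p1 q1 r1 with ⟨c4, h4⟩ | ⟨c4, h4⟩ | ⟨c4, t4, e4, ⟨p4, q4, r4⟩, h4⟩
      · exact h4
      · omega
      · omega
    · rw [h3, map_zero]
    · rw [h3]
      rcases A t3 y z x p3 q3 r3 with ⟨c4, h4⟩ | ⟨c4, h4⟩ | ⟨c4, t4, e4, ⟨p4, q4, r4⟩, h4⟩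
      · exact h4
      · omega
      · omega
  · -- the case `t1 = (y, x, z)`, where `y`, `z` are attacking
    rcases B t1 y x z p1 q1 r1 with ⟨c3, h3⟩ | ⟨c3, h3⟩ | ⟨c3, t3, e3, ⟨p3, q3, r3⟩, h3⟩
    · omega
    · rw [h3, map_zero]
    · rw [h3]
      rcases A t3 y z x p3 q3 r3 with ⟨c4, h4⟩ | ⟨c4, h4⟩ | ⟨c4, t4, e4, ⟨p4, q4, r4⟩, h4⟩
      · omega
      · exact h4
      · omega
  · -- all swaps happen
    rcases B t1 y x z p1 q1 r1 with ⟨c3, h3⟩ | ⟨c3, h3⟩ | ⟨c3, t3, e3, ⟨p3, q3, r3⟩, h3⟩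
    · omega
    · omega
    rcases A t3 y z x p3 q3 r3 with ⟨c4, h4⟩ | ⟨c4, h4⟩ | ⟨c4, t4, e4, ⟨p4, q4, r4⟩, h4⟩
    · omega
    · omega
    rcases A t2 x z y p2 q2 r2 with ⟨c5, h5⟩ | ⟨c5, h5⟩ | ⟨c5, t5, e5, ⟨p5, q5, r5⟩, h5⟩
    · omega
    · omega
    rcases B t5 z x y p5 q5 r5 with ⟨c6, h6⟩ | ⟨c6, h6⟩ | ⟨c6, t6, e6, ⟨p6, q6, r6⟩, h6⟩
    · omega
    · omega
    rw [h3, h4, h5, h6]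
    congr 1
    apply ext_fun
    rw [e4, e3, e1, e6, e5, e2]
    funext b
    simp only [hij]
    exact swap_braid i.1 (τ.toFun b)

end SPCT

/-! ### The module spanned by the tableaux -/

section SMod

variable {n : ℕ} (α : Composition n) (σ : Equiv.Perm (Fin α.length))

/-- The action of `H_n(0)` on the `ℂ`-span of `SPCT α σ`, as an algebra homomorphism. -/
noncomputable def rep : ZeroHecke n →ₐ[ℂ] Module.End ℂ (SPCT α σ →₀ ℂ) :=
  RingQuot.liftAlgHom ℂ ⟨FreeAlgebra.lift ℂ fun i => SPCT.op i, by
    intro a b h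
    cases h with
    | idem i => simpa using SPCT.op_idem i
    | braid i j h => simpa using SPCT.op_braid i j h
    | comm i j h => simpa using SPCT.op_comm i j h⟩

/-- The underlying space of the module `S^σ_α`: the `ℂ`-span of `SPCT α σ`. -/
def SMod : Type := SPCT α σ →₀ ℂ

noncomputable instance : AddCommGroup (SMod α σ) :=
  inferInstanceAs (AddCommGroup (SPCT α σ →₀ ℂ))

noncomputable instance : Module ℂ (SMod α σ) :=
  inferInstanceAs (Module ℂ (SPCT α σ →₀ ℂ))

/-- The `H_n(0)`-module structure on `S^σ_α`. -/
noncomputable instance : Module (ZeroHecke n) (SMod α σ) :=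
  letI : Module (Module.End ℂ (SPCT α σ →₀ ℂ)) (SMod α σ) :=
    inferInstanceAs (Module (Module.End ℂ (SPCT α σ →₀ ℂ)) (SPCT α σ →₀ ℂ))
  Module.compHom (SMod α σ) (rep α σ).toRingHom

variable {α σ}

/-- A tableau as a basis vector of `S^σ_α`. -/
noncomputable def SPCT.vec (τ : SPCT α σ) : SMod α σ := (Finsupp.single τ 1 : SPCT α σ →₀ ℂ)

/-- The generator `π_i` acts on the basis of tableaux through `act`. -/
theorem pi_smul_vec (i : Gen n) (τ : SPCT α σ) :
    (ZeroHecke.pi i • τ.vec : SMod α σ) = (SPCT.act i τ : SPCT α σ →₀ ℂ) := by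
  change rep α σ (ZeroHecke.pi i) (Finsupp.single τ 1) = _
  rw [← SPCT.op_single]
  simp [rep, ZeroHecke.pi]

variable (α σ)

/-- `S^σ_α` is SPCT-cyclic: it is generated, as an `H_n(0)`-module, by a single tableau. -/
def IsSPCTCyclic : Prop :=
  ∃ τ : SPCT α σ, Submodule.span (ZeroHecke n) {τ.vec} = ⊤

end SMod

/-! ### Simple compositions -/

section Simple

variable {n : ℕ} (α : Composition n) (σ : Equiv.Perm (Fin α.length))

/-- `α` is compatible with `σ`. -/
def IsCompatible : Prop :=
  ∀ i j : Fin α.length, i < j → σ j < σ i → α.blocksFun j ≤ α.blocksFun i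

/-- `(i, j)` is a permutation-ascending composition-descending pair attached to `(α; σ)`. -/
def IsPACD (i j : Fin α.length) : Prop :=
  i < j ∧ σ i < σ j ∧ α.blocksFun j ≤ α.blocksFun i ∧ 2 ≤ α.blocksFun j

/-- Condition C1 for the pair `(i, j)`; note that `α_j ≥ 2` for a PACD pair. -/
def CondC1 (i j : Fin α.length) : Prop :=
  ∃ k : Fin α.length, i < k ∧ k < j ∧ σ i < σ k ∧ σ k < σ j ∧
    α.blocksFun k + 1 = α.blocksFun j

/-- Condition C2 for the pair `(i, j)`. -/
def CondC2 (i j : Fin α.length) : Prop :=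
  ∃ k : Fin α.length, j < k ∧ σ i < σ k ∧ σ k < σ j ∧ α.blocksFun k = α.blocksFun j

/-- `α` is `σ`-simple. Being compatible with `σ` is part of the notion. -/
def IsSimple : Prop :=
  IsCompatible α σ ∧ ∀ i j : Fin α.length, IsPACD α σ i j → CondC1 α σ i j ∨ CondC2 α σ i j

end Simple

end PermComp

namespace PermComp

/-! ### Coordinates of boxes -/

section Boxes

variable {n : ℕ} {α : Composition n}

/-! Both equivalences reduce to one statement about column equivalence, the relation that two
tableaux order the entries of every column alike.

A generator never swaps two entries of one column, so the span of each class is a submodule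
(`SPCT.smul_mem_supported`). Each class contains exactly one source tableau, which generates that
span. For existence, a tableau that is not a source can be written as `π_i` applied to another
tableau of its class with larger weight (the sum of column times entry), so climbing must stop at a
source (`SPCT.exists_isSource`). Uniqueness compares two sources at the largest entry they place
differently (`SPCT.IsSource.eq_of_colEquiv`). Hence a unique source, and likewise a generating
tableau, exists exactly when there is exactly one class.

There is exactly one class if and only if `α` is `σ`-simple. If `α` is simple, the triple condition
forces every column to be ordered as `σ` (`SPCT.lt_of_isSimple`). Conversely, any tableau forces
compatibility; if some PACD pair satisfies neither C1 nor C2, the row-by-row filling and a variant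
with one box moved order some column differently (`SPCT.exists_lt_of_not_cond`). -/

theorem Box.ext_row_col {x y : Box α} (hr : x.row = y.row) (hc : x.col = y.col) : x = y := by
  obtain ⟨i, c, hc'⟩ := x
  obtain ⟨j, d, hd'⟩ := y
  simp only [Box.row, Box.col] at hr hc
  subst hr
  subst hc
  rfl

theorem Box.col_lt (x : Box α) : x.col < α.blocksFun x.row := x.2.2

theorem Box.col_lt_size (x : Box α) : x.col < n :=
  x.col_lt.trans_le (α.blocksFun_le x.row)

end Boxes

namespace SPCT

variable {n : ℕ} {α : Composition n} {σ : Equiv.Perm (Fin α.length)}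

/-! ### Column orders forced by the triple condition -/

theorem first_lt_iff (τ : SPCT α σ) (i j : Fin α.length) :
    τ.toFun (firstBox α i) < τ.toFun (firstBox α j) ↔ σ i < σ j := by
  rcases lt_trichotomy i j with h | rfl | h
  · have h1 := τ.isPCT.first.2 i j h
    have h2 : τ.toFun (firstBox α i) ≠ τ.toFun (firstBox α j) := fun e =>
      h.ne (τ.isPCT.first.1 e)
    have h3 : σ i ≠ σ j := fun e => h.ne (σ.injective e)
    constructor
    · intro h4
      exact lt_of_le_of_ne (not_lt.1 fun h5 => h4.asymm (h1.1 h5)) h3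
    · intro h4
      exact lt_of_le_of_ne (not_lt.1 fun h5 => h4.asymm (h1.2 h5)) h2
  · simp
  · exact (τ.isPCT.first.2 j i h).symm

/-- The entries of each row strictly decrease. -/
theorem row_lt (τ : SPCT α σ) {x y : Box α} (hr : x.row = y.row) (hc : x.col < y.col) :
    τ.toFun y < τ.toFun x := by
  refine lt_of_le_of_ne (τ.isPCT.rows x y hr hc.le) fun h => ?_
  rw [τ.inj h] at hc
  exact lt_irrefl _ hc

/-- If the entry of row `i` exceeds that of a lower row `j` in some column, then it does so in all
later columns reached by row `j`. -/
theorem lower_row_lt (τ : SPCT α σ) {i j : Fin α.length} (hij : i < j) {c : ℕ}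
    (hi : c < α.blocksFun i) (hj : c < α.blocksFun j)
    (h : τ.toFun ⟨j, c, hj⟩ < τ.toFun ⟨i, c, hi⟩) {d : ℕ} (hcd : c ≤ d) :
    ∀ hd : d < α.blocksFun j, ∃ hd' : d < α.blocksFun i,
      τ.toFun ⟨j, d, hd⟩ < τ.toFun ⟨i, d, hd'⟩ := by
  induction d, hcd using Nat.le_induction with
  | base => exact fun _ => ⟨hi, h⟩
  -- The row decrease gives `τ(j, d + 1) < τ(j, d) < τ(i, d)`; the triple condition then supplies
  -- the box `(i, d + 1)` with a larger entry.
  | succ d _ ih =>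
    intro hd
    obtain ⟨hd', hlt⟩ := ih (by omega)
    have hrow : τ.toFun ⟨j, d + 1, hd⟩ < τ.toFun ⟨j, d, by omega⟩ :=
      τ.row_lt rfl (Nat.lt_succ_self d)
    obtain ⟨z, hz1, hz2, hz3⟩ :=
      τ.isPCT.triple ⟨i, d, hd'⟩ ⟨j, d + 1, hd⟩ hij rfl (hrow.trans hlt)
    have hz1' : z.row = i := hz1
    have hz2' : z.col = d + 1 := hz2
    have hz := z.col_lt
    rw [hz1', hz2'] at hz
    have e : z = ⟨i, d + 1, hz⟩ := Box.ext_row_col hz1 hz2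
    exact ⟨hz, e ▸ hz3⟩

/-- An inversion of `σ` is an inequality in column `0`, which `lower_row_lt` carries along all of
row `j`. In particular row `i` is at least as long, which gives compatibility. -/
theorem inversion_lt (τ : SPCT α σ) {i j : Fin α.length} (hij : i < j) (hσ : σ j < σ i) {d : ℕ}
    (hd : d < α.blocksFun j) : ∃ hd' : d < α.blocksFun i,
      τ.toFun ⟨j, d, hd⟩ < τ.toFun ⟨i, d, hd'⟩ :=
  τ.lower_row_lt hij (α.one_le_blocksFun i) (α.one_le_blocksFun j)
    ((τ.first_lt_iff j i).2 hσ) (Nat.zero_le d) hd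

theorem isCompatible (τ : SPCT α σ) : IsCompatible α σ := by
  intro i j hij hσ
  have := α.one_le_blocksFun j
  obtain ⟨h, -⟩ := τ.inversion_lt hij hσ (d := α.blocksFun j - 1) (by omega)
  omega

/-- For a `σ`-simple composition, the entries of every column are ordered as `σ`. -/
theorem lt_of_isSimple (τ : SPCT α σ) (hs : IsSimple α σ) (N : ℕ) :
    ∀ i j : Fin α.length, (σ j : ℕ) = N → σ i < σ j → ∀ (c : ℕ) (hi : c < α.blocksFun i)
      (hj : c < α.blocksFun j), τ.toFun ⟨i, c, hi⟩ < τ.toFun ⟨j, c, hj⟩ := by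
  induction N using Nat.strong_induction_on with
  -- The induction is on `σ j`: in both C1 and C2 the row `k` has `σ k < σ j`, so the order of rows
  -- `i` and `k` is already known.
  | _ N ih =>
  intro i j hN hσ c hi hj
  rcases lt_trichotomy i j with hij | rfl | hij
  · by_contra hcon
    have hne : τ.toFun ⟨j, c, hj⟩ ≠ τ.toFun ⟨i, c, hi⟩ := fun e =>
      hij.ne' (congrArg Sigma.fst (τ.inj e))
    have hlt := lt_of_le_of_ne (not_lt.1 hcon) hne
    have hc : c ≠ 0 := by
      rintro rfl
      exact hcon ((τ.first_lt_iff i j).2 hσ)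
    -- A wrong order in column `c` persists to the last box of row `j`. Hence `α_i ≥ α_j`, and `c ≠
    -- 0` gives `α_j ≥ 2`: the pair is PACD.
    obtain ⟨hd', hd⟩ := τ.lower_row_lt hij hi hj hlt (d := α.blocksFun j - 1) (by omega)
      (by omega)
    rcases hs.2 i j ⟨hij, hσ, by omega, by omega⟩ with
      ⟨k, hik, hkj, hσik, hσkj, hk⟩ | ⟨k, hjk, hσik, hσkj, hk⟩
    -- C1: the last entry of row `j` is below the last entry of row `k`, one column to the left, so
    -- the triple condition would lengthen row `k`.
    · have h1 := ih (σ k) (hN ▸ hσkj) i k rfl hσik (α.blocksFun j - 2) (by omega) (by omega)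
      have h2 : τ.toFun ⟨i, α.blocksFun j - 1, hd'⟩ <
          τ.toFun ⟨i, α.blocksFun j - 2, by omega⟩ :=
        τ.row_lt rfl (by simp only [Box.col]; omega)
      obtain ⟨z, hz1, hz2, -⟩ := τ.isPCT.triple ⟨k, α.blocksFun j - 2, by omega⟩
        ⟨j, α.blocksFun j - 1, by omega⟩ hkj (by simp only [Box.col]; omega) (by omega)
      have hz := z.col_lt
      rw [hz1, hz2] at hz
      simp only [Box.col, Box.row] at hz
      omega
    -- C2: in the last column of row `j` the entries would satisfy `k < j < i`, while induction
    -- gives `i < k`.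
    · have h1 := ih (σ k) (hN ▸ hσkj) i k rfl hσik (α.blocksFun j - 1) (by omega) (by omega)
      obtain ⟨_, h2⟩ := τ.inversion_lt hjk hσkj (d := α.blocksFun j - 1) (by omega)
      omega
  · exact absurd hσ (lt_irrefl _)
  · exact (τ.inversion_lt hij hσ hi).2

theorem lt_iff_of_isSimple (τ : SPCT α σ) (hs : IsSimple α σ) {x y : Box α}
    (h : x.col = y.col) : τ.toFun x < τ.toFun y ↔ σ x.row < σ y.row := by
  obtain ⟨i, c, hi⟩ := x
  obtain ⟨j, d, hj⟩ := y
  simp only [Box.row, Box.col] at h ⊢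
  subst h
  refine ⟨fun hlt => ?_, fun hσ => τ.lt_of_isSimple hs _ i j rfl hσ c hi hj⟩
  by_contra hσ
  rcases (not_lt.1 hσ).lt_or_eq with h1 | h1
  · exact hlt.asymm (τ.lt_of_isSimple hs _ j i rfl h1 c hj hi)
  · obtain rfl := σ.injective h1
    exact lt_irrefl _ hlt

/-- Two tableaux are column equivalent if the entries of each column are ordered in the same
way. -/
def ColEquiv (τ τ' : SPCT α σ) : Prop :=
  ∀ x y : Box α, x.col = y.col → (τ.toFun x < τ.toFun y ↔ τ'.toFun x < τ'.toFun y)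

theorem ColEquiv.symm {τ τ' : SPCT α σ} (h : ColEquiv τ τ') : ColEquiv τ' τ :=
  fun x y hxy => (h x y hxy).symm

theorem ColEquiv.trans {τ τ' τ'' : SPCT α σ} (h : ColEquiv τ τ') (h' : ColEquiv τ' τ'') :
    ColEquiv τ τ'' :=
  fun x y hxy => (h x y hxy).trans (h' x y hxy)

theorem colEquiv_of_isSimple (hs : IsSimple α σ) (τ τ' : SPCT α σ) : ColEquiv τ τ' :=
  fun _ _ h => (τ.lt_iff_of_isSimple hs h).trans (τ'.lt_iff_of_isSimple hs h).symm

/-! ### Standardization of a filling -/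

/-- A filling with distinct entries in a linear order, satisfying the tableau conditions, is
standardized to a tableau. -/
theorem exists_lt_iff_lt {γ : Type*} [LinearOrder γ] (f : Box α → γ)
    (hf : Function.Injective f)
    (hfirst : ∀ i j, f (firstBox α i) < f (firstBox α j) ↔ σ i < σ j)
    (hrow : ∀ x y : Box α, x.row = y.row → x.col ≤ y.col → f y ≤ f x)
    (htriple : ∀ x y : Box α, x.row < y.row → y.col = x.col + 1 → f y < f x →
      ∃ z : Box α, z.row = x.row ∧ z.col = y.col ∧ f y < f z) :
    ∃ τ : SPCT α σ, ∀ x y, τ.toFun x < τ.toFun y ↔ f x < f y := by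
  classical
  -- The rank of a box, counted from `1`.
  let g : Box α → ℕ := fun x => (Finset.univ.filter fun y => f y ≤ f x).card
  have hmono : ∀ x y, f x ≤ f y → g x ≤ g y := fun x y h =>
    Finset.card_le_card fun z hz => by
      simp only [Finset.mem_filter, Finset.mem_univ, true_and] at hz ⊢
      exact hz.trans h
  have hstrict : ∀ x y, f x < f y → g x < g y := fun x y h =>
    Finset.card_lt_card (Finset.ssubset_iff_of_subset (fun z hz => by
      simp only [Finset.mem_filter, Finset.mem_univ, true_and] at hz ⊢
      exact hz.trans h.le) |>.2 ⟨y, by simp, by simpa using h⟩)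
  have hiff : ∀ x y, g x < g y ↔ f x < f y := fun x y =>
    ⟨fun h => not_le.1 fun h' => (hmono y x h').not_gt h, hstrict x y⟩
  have hinj : Function.Injective g := fun x y h => hf (le_antisymm
    (not_lt.1 fun h' => (hstrict y x h').ne' h) (not_lt.1 fun h' => (hstrict x y h').ne h))
  refine ⟨⟨g, ⟨?_, ⟨?_, ?_⟩, ?_, ?_⟩, hinj, ?_⟩, hiff⟩
  · exact fun x => Finset.card_pos.2 ⟨x, by simp⟩
  · exact fun i j h => congrArg Sigma.fst (hinj h)
  · exact fun i j _ => ((hiff _ _).trans (hfirst j i)).symm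
  · exact fun x y hr hc => hmono y x (hrow x y hr hc)
  · intro x y hr hc h
    obtain ⟨z, h1, h2, h3⟩ := htriple x y hr hc ((hiff _ _).1 h)
    exact ⟨z, h1, h2, (hiff _ _).2 h3⟩
  · intro x
    refine (Finset.card_le_univ _).trans ?_
    simp [α.sum_blocksFun]

/-- The row-by-row filling, with rows taken in the order of `σ`. -/
theorem exists_rowFilling (h : IsCompatible α σ) :
    ∃ τ : SPCT α σ, ∀ x y : Box α, σ x.row < σ y.row → τ.toFun x < τ.toFun y := by
  refine (exists_lt_iff_lt (fun x => toLex ((σ x.row : ℕ), n - x.col)) ?_ ?_ ?_ ?_).imp ?_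
  · intro x y hxy
    obtain ⟨h1, h2⟩ := Prod.ext_iff.1 (toLex.injective hxy)
    have := x.col_lt_size
    have := y.col_lt_size
    dsimp only at h1 h2
    exact Box.ext_row_col (σ.injective (Fin.ext h1)) (by omega)
  · intro i j
    rw [Prod.Lex.lt_iff]
    simp [Box.row, Box.col, firstBox]
  · intro x y hr hc
    rw [Prod.Lex.le_iff]
    right
    simp only [ofLex_toLex, hr, true_and]
    omega
  · intro x y hr hc hlt
    rw [Prod.Lex.lt_iff] at hlt
    have hσ : σ y.row < σ x.row := by
      rcases hlt with hlt | ⟨hlt, -⟩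
      · exact hlt
      · exact absurd (σ.injective (Fin.ext hlt)) hr.ne'
    have hle := h _ _ hr hσ
    refine ⟨⟨x.row, y.col, y.col_lt.trans_le hle⟩, rfl, rfl, ?_⟩
    rw [Prod.Lex.lt_iff]
    exact Or.inl hσ
  · intro τ hτ x y hxy
    rw [hτ, Prod.Lex.lt_iff]
    exact Or.inl hxy

/-- For a PACD pair satisfying neither C1 nor C2, the last box of row `j` can be given an entry
smaller than that of row `i` in the same column. -/
theorem exists_lt_of_not_cond (h : IsCompatible α σ) {i j : Fin α.length} (hp : IsPACD α σ i j)
    (h1 : ¬ CondC1 α σ i j) (h2 : ¬ CondC2 α σ i j) :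
    ∃ (τ : SPCT α σ) (x y : Box α), x.row = i ∧ y.row = j ∧ x.col = y.col ∧
      τ.toFun y < τ.toFun x := by
  classical
  obtain ⟨hij, hσ, hle, htwo⟩ := hp
  -- the last box of row `j` comes right before the box of row `i` in its column
  let P : Box α → Prop := fun x => x.row = j ∧ x.col + 1 = α.blocksFun j
  let a : Box α → ℕ := fun x => if P x then σ i else σ x.row
  -- Doubling leaves odd values free, so the moved box fits immediately below the box of row `i` in
  -- its column, and parity keeps the keys distinct.
  let b : Box α → ℕ := fun x => if P x then 2 * (n - x.col) - 1 else 2 * (n - x.col)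
  have hσij : (σ i : ℕ) < σ j := hσ
  have hlex : ∀ x y, toLex (a x, b x) < toLex (a y, b y) ↔ a x < a y ∨ a x = a y ∧ b x < b y :=
    fun x y => Prod.Lex.lt_iff
  have cmp : ∀ {r s : Fin α.length}, r < s → (σ s : ℕ) < σ r →
      α.blocksFun s ≤ α.blocksFun r := fun hr hs => h _ _ hr hs
  have rowinj : ∀ {r s : Fin α.length}, (σ r : ℕ) = σ s → r = s := fun e =>
    σ.injective (Fin.ext e)
  refine (exists_lt_iff_lt (fun x => toLex (a x, b x)) ?_ ?_ ?_ ?_).imp ?_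
  · intro x y hxy
    obtain ⟨e1, e2⟩ := Prod.ext_iff.1 (toLex.injective hxy)
    have := x.col_lt_size
    have := y.col_lt_size
    simp only [a, b] at e1 e2
    split_ifs at e1 e2 with hx hy hy
    · exact Box.ext_row_col (hx.1.trans hy.1.symm) (by omega)
    · omega
    · omega
    · exact Box.ext_row_col (rowinj e1) (by omega)
  · intro r s
    -- The moved box is not in column `0`, since `α_j ≥ 2`.
    have hP : ∀ r, ¬ P (firstBox α r) := fun r hP => by
      have := hP.2
      simp only [Box.col, firstBox] at this
      omega
    rw [hlex]
    simp only [a, b, if_neg (hP _)]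
    simp [Box.row, Box.col, firstBox]
  · intro x y hr hc
    rw [← not_lt, hlex]
    have := x.col_lt_size
    have := y.col_lt_size
    have := x.col_lt
    have := y.col_lt
    simp only [a, b]
    by_cases hy : P y
    · by_cases hx : P x
      · simp only [if_pos hx, if_pos hy]
        omega
      · simp only [if_neg hx, if_pos hy]
        rw [hr, hy.1]
        omega
    · by_cases hx : P x
      · refine absurd ⟨hr ▸ hx.1, ?_⟩ hy
        have hx1 := hx.1
        have hx2 := hx.2
        rw [← hr, hx1] at this
        omega
      · simp only [if_neg hx, if_neg hy, hr]
        omega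
  · intro x y hr hc hlt
    rw [hlex] at hlt
    have := x.col_lt_size
    have := y.col_lt_size
    have hxl := x.col_lt
    have hyl := y.col_lt
    by_cases hy : P y
    · -- the moved box on the right
      have hx : ¬ P x := fun hx => by
        have := hx.2
        have := hy.2
        omega
      have hy1 := hy.1
      have hy2 := hy.2
      rw [hy1] at hr hyl
      simp only [a, b, if_pos hy, if_neg hx] at hlt
      -- Row `x.row` already reaches the preceding column. It could only be too short if it had
      -- length `α_j - 1`, and then it would witness C1.
      have hlen : α.blocksFun j ≤ α.blocksFun x.row := by
        rcases lt_trichotomy (σ x.row : ℕ) (σ j) with h3 | h3 | h3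
        · rcases hlt with h4 | ⟨h4, -⟩
          · rcases lt_trichotomy i x.row with h5 | h5 | h5
            · by_contra hcon
              exact h1 ⟨x.row, h5, hr, h4, h3, by omega⟩
            · rwa [← h5]
            · exact hle.trans (cmp h5 h4)
          · rwa [← rowinj h4]
        · exact absurd (rowinj h3) hr.ne
        · exact cmp hr h3
      refine ⟨⟨x.row, y.col, by omega⟩, rfl, rfl, (hlex _ _).2 ?_⟩
      have hz : ¬ P ⟨x.row, y.col, by omega⟩ := fun hz => hr.ne hz.1
      simp only [a, b, if_pos hy, if_neg hz]
      simp only [Box.row, Box.col] at *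
      omega
    · by_cases hx : P x
      · -- the moved box on the left
        exfalso
        simp only [a, b, if_neg hy, if_pos hx] at hlt
        have hx1 := hx.1
        have hx2 := hx.2
        rw [hx1] at hr
        -- Here `y.row` lies below row `j` and is longer, so compatibility excludes `σ y.row < σ j`.
        rcases hlt with h4 | ⟨h4, -⟩
        · have := cmp hr (h4.trans hσij)
          omega
        · rw [rowinj h4] at hr
          exact hr.asymm hij
      · simp only [a, b, if_neg hy, if_neg hx] at hlt
        have hσ' : (σ y.row : ℕ) < σ x.row := by
          rcases hlt with hlt | ⟨hlt, -⟩
          · exact hlt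
          · exact absurd (rowinj hlt) hr.ne'
        have hlen := cmp hr hσ'
        refine ⟨⟨x.row, y.col, by omega⟩, rfl, rfl, (hlex _ _).2 ?_⟩
        -- The required box may itself be the moved one. Its lowered entry is too small only if `σ i
        -- < σ y.row < σ j`; then compatibility gives `α_{y.row} = α_j`, which is C2.
        by_cases hz : P ⟨x.row, y.col, by omega⟩
        · have hz1 : x.row = j := hz.1
          have hz2 : y.col + 1 = α.blocksFun j := hz.2
          rw [hz1] at hr hσ' hlen
          simp only [a, b, if_neg hy, if_pos hz]
          left
          rcases lt_trichotomy (σ y.row : ℕ) (σ i) with h3 | h3 | h3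
          · exact h3
          · rw [rowinj h3] at hr
            exact absurd hij hr.asymm
          · exact absurd ⟨y.row, hr, h3, hσ', by omega⟩ h2
        · simp only [a, b, if_neg hy, if_neg hz]
          exact Or.inl hσ'
  · refine fun τ hτ => ⟨⟨i, α.blocksFun j - 1, by omega⟩, ⟨j, α.blocksFun j - 1, by omega⟩, rfl, rfl, rfl,
      (hτ _ _).2 ((hlex _ _).2 ?_)⟩
    have := α.blocksFun_le j
    have hPj : P ⟨j, α.blocksFun j - 1, by omega⟩ := ⟨rfl, by simp only [Box.col]; omega⟩
    have hPi : ¬ P ⟨i, α.blocksFun j - 1, by omega⟩ := fun hP => hij.ne hP.1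
    simp only [a, b, if_pos hPj, if_neg hPi]
    simp only [Box.row, Box.col]
    exact Or.inr ⟨trivial, by omega⟩

/-- If all tableaux are column equivalent, the composition is simple. -/
theorem isSimple_of_colEquiv [Nonempty (SPCT α σ)]
    (h : ∀ τ τ' : SPCT α σ, ColEquiv τ τ') : IsSimple α σ := by
  have hc := (Classical.arbitrary (SPCT α σ)).isCompatible
  refine ⟨hc, fun i j hp => ?_⟩
  by_contra hcon
  rw [not_or] at hcon
  obtain ⟨τ, x, y, rfl, rfl, hcol, hlt⟩ := exists_lt_of_not_cond hc hp hcon.1 hcon.2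
  obtain ⟨τ', hτ'⟩ := exists_rowFilling hc
  exact hlt.asymm ((h τ τ' x y hcol).2 (hτ' x y hp.2.1))

/-! ### Source tableaux -/

/-- Entries in one column attack each other, so a nonzero action never exchanges them. -/
theorem ColEquiv.of_act {τ τ' : SPCT α σ} {i : Gen n} (h : τ' ∈ (act i τ).support) :
    ColEquiv τ τ' := by
  unfold act at h
  split_ifs at h with hd ha
  · simp at h
  · have e : τ' = τ.swap i hd ha := by
      simpa using Finsupp.support_single_subset h
    subst e
    intro x y hxy
    refine (swap_lt_iff _ _ _ ?_ ?_).symm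
    · rintro ⟨hx, hy⟩
      exact ha ((τ.attacking_iff hx hy).2 (Or.inl hxy))
    · rintro ⟨hx, hy⟩
      exact ha ((τ.attacking_iff hy hx).2 (Or.inl hxy.symm))
  · have e : τ' = τ := by
      simpa using Finsupp.support_single_subset h
    subst e
    exact fun _ _ _ => Iff.rfl

/-- A tableau that is not a source tableau is obtained from another one by a generator, which
moves a larger entry to the left. -/
theorem exists_act_eq_single (τ : SPCT α σ) (h : ¬ τ.IsSource) :
    ∃ (i : Gen n) (τ' : SPCT α σ), act i τ' = Finsupp.single τ 1 ∧
      ∑ x, x.col * τ.toFun x < ∑ x, x.col * τ'.toFun x := by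
  unfold IsSource at h
  push Not at h
  obtain ⟨i, hi1, hin, hd, hleft⟩ := h
  obtain ⟨x, hx⟩ := τ.exists_box i hi1 hin.le
  obtain ⟨y, hy⟩ := τ.exists_box (i + 1) (by omega) hin
  rw [τ.isDescent_iff hx hy, not_le] at hd
  -- In a common row, the box just right of `i + 1` would hold an entry strictly between `i` and `i
  -- + 1`.
  have hrow : x.row ≠ y.row := by
    intro hr
    have hcl := x.col_lt
    let z : Box α := ⟨x.row, y.col + 1, by omega⟩
    have hne : x.col ≠ y.col + 1 := hleft x y hx hy hr.symm
    have h1 : τ.toFun z < τ.toFun y := τ.row_lt hr.symm (Nat.lt_succ_self _)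
    have h2 : τ.toFun x < τ.toFun z := τ.row_lt rfl (show y.col + 1 < x.col by omega)
    omega
  -- Otherwise the triple condition again yields an entry strictly between `i` and `i + 1`.
  have hatt : ¬ (x.col = y.col + 1 ∧ y.row < x.row) := by
    rintro ⟨hc, hr⟩
    obtain ⟨z, hz1, hz2, hz3⟩ := τ.isPCT.triple y x hr hc (by omega)
    have := τ.row_lt hz1.symm (show y.col < z.col by omega)
    omega
  have hswap : ∀ u v : Box α, ¬ (u = x ∧ v = y) → ¬ (u = y ∧ v = x) →
      (Equiv.swap i (i + 1) (τ.toFun u) < Equiv.swap i (i + 1) (τ.toFun v) ↔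
        τ.toFun u < τ.toFun v) := by
    intro u v h1 h2
    refine swap_lt_iff _ _ _ ?_ ?_
    · rintro ⟨hu, hv⟩
      exact h1 ⟨τ.inj (hu.trans hx.symm), τ.inj (hv.trans hy.symm)⟩
    · rintro ⟨hu, hv⟩
      exact h2 ⟨τ.inj (hu.trans hy.symm), τ.inj (hv.trans hx.symm)⟩
  have hcol : ∀ u v : Box α, u.col = v.col →
      (Equiv.swap i (i + 1) (τ.toFun u) < Equiv.swap i (i + 1) (τ.toFun v) ↔
        τ.toFun u < τ.toFun v) := by
    intro u v huv
    refine hswap u v ?_ ?_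
    · rintro ⟨rfl, rfl⟩
      omega
    · rintro ⟨rfl, rfl⟩
      omega
  let τ' : SPCT α σ := {
    toFun := fun u => Equiv.swap i (i + 1) (τ.toFun u)
    isPCT := by
      refine ⟨fun u => ?_, ⟨fun r s h => ?_, fun r s hrs => ?_⟩, fun u v hr hc => ?_,
        fun u v hr hc hlt => ?_⟩
      · have := τ.isPCT.pos u
        simp only [Equiv.swap_apply_def]
        split_ifs <;> omega
      · exact τ.isPCT.first.1 ((Equiv.swap i (i + 1)).injective h)
      · exact (τ.isPCT.first.2 r s hrs).trans (hcol (firstBox α s) (firstBox α r) rfl).symm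
      · rw [← not_lt, hswap, not_lt]
        · exact τ.isPCT.rows u v hr hc
        · rintro ⟨rfl, rfl⟩
          exact hrow hr
        · rintro ⟨rfl, rfl⟩
          exact hrow hr.symm
      · rw [hswap] at hlt
        · obtain ⟨z, hz1, hz2, hz3⟩ := τ.isPCT.triple u v hr hc hlt
          exact ⟨z, hz1, hz2, (hcol v z hz2.symm).2 hz3⟩
        · rintro ⟨rfl, rfl⟩
          exact hatt ⟨hc, hr⟩
        · rintro ⟨rfl, rfl⟩
          omega
    inj := fun u v h => τ.inj ((Equiv.swap i (i + 1)).injective h)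
    le := fun u => by
      have := τ.le u
      simp only [Equiv.swap_apply_def]
      split_ifs <;> omega }
  have hx' : τ'.toFun x = i + 1 := by simp [τ', hx]
  have hy' : τ'.toFun y = i := by simp [τ', hy]
  have hd' : τ'.IsDescent i := (τ'.isDescent_iff hy' hx').2 hd.le
  have ha' : ¬ τ'.Attacking i (i + 1) := by
    rw [τ'.attacking_iff hy' hx', not_or]
    exact ⟨by omega, hatt⟩
  refine ⟨⟨i, hi1, hin⟩, τ', ?_, ?_⟩
  · unfold act
    rw [dif_pos hd', dif_neg ha']
    congr 1
    apply ext_fun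
    funext u
    simp [swap, τ']
  · classical
    -- Undoing the swap changes the weight by `x.col - y.col > 0`; the correction terms avoid
    -- subtraction in `ℕ`.
    have key : ∀ u : Box α, u.col * τ'.toFun u + (if u = y then y.col else 0) =
        u.col * τ.toFun u + (if u = x then x.col else 0) := by
      intro u
      by_cases hux : u = x
      · have hne : x ≠ y := fun e => hrow (congrArg Box.row e)
        subst hux
        rw [hx', hx, if_pos rfl, if_neg hne, mul_add, mul_one, add_zero]
      · by_cases huy : u = y
        · subst huy
          rw [hy', hy, if_pos rfl, if_neg hux, mul_add, mul_one, add_zero]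
        · rw [if_neg hux, if_neg huy]
          have e : τ'.toFun u = τ.toFun u := Equiv.swap_apply_of_ne_of_ne
            (fun e => hux (τ.inj (e.trans hx.symm))) (fun e => huy (τ.inj (e.trans hy.symm)))
          rw [e]
    have hsum := Finset.sum_congr (rfl : (Finset.univ : Finset (Box α)) = _) fun u _ => key u
    rw [Finset.sum_add_distrib, Finset.sum_add_distrib, Finset.sum_ite_eq', Finset.sum_ite_eq',
      if_pos (Finset.mem_univ _), if_pos (Finset.mem_univ _)] at hsum
    omega

/-- The core of uniqueness. If `m` sat further right in `τ'`, then in `τ` the entries below `m`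
would have to leave the columns from `y.col` on, through a step that is not a descent. The source
condition makes that step start at `y` and end at its left neighbour, whose entry in `τ` is then at
most `m`. In `τ'` this neighbour exceeds `m`, contradicting the agreement above `m`. -/
theorem IsSource.not_col_lt {τ τ' : SPCT α σ} (hs : τ.IsSource) (h : ColEquiv τ τ') {m : ℕ}
    (hagree : ∀ z, m < τ.toFun z ∨ m < τ'.toFun z → τ.toFun z = τ'.toFun z) {x y : Box α}
    (hx : τ.toFun x = m) (hy : τ'.toFun y = m) : ¬ x.col < y.col := by
  intro hxy
  have hym : τ.toFun y < m := by
    rcases lt_trichotomy (τ.toFun y) m with h1 | h1 | h1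
    · exact h1
    · rw [τ.inj (h1.trans hx.symm)] at hxy
      exact absurd hxy (lt_irrefl _)
    · have := hagree y (Or.inl h1)
      omega
  obtain ⟨u, hu, hmax⟩ := Finset.exists_max_image
    (Finset.univ.filter fun u : Box α => τ.toFun u < m ∧ y.col ≤ u.col) τ.toFun
    ⟨y, by simpa using hym⟩
  simp only [Finset.mem_filter, Finset.mem_univ, true_and] at hu hmax
  have hmn : m ≤ n := hx ▸ τ.le x
  obtain ⟨v, hv⟩ := τ.exists_box (τ.toFun u + 1) (by omega) (by omega)
  have hvy : v.col < y.col := by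
    rcases (Nat.succ_le_of_lt hu.1).lt_or_eq with h1 | h1
    · by_contra hcon
      have := hmax v ⟨by omega, not_lt.1 hcon⟩
      omega
    · rwa [τ.inj (hv.trans (h1.trans hx.symm))]
  obtain ⟨u', v', hu', hv', hr, hc⟩ := hs (τ.toFun u) (τ.isPCT.pos u) (by omega)
    (by rw [τ.isDescent_iff rfl hv]; omega)
  obtain rfl := τ.inj hu'
  obtain rfl := τ.inj (hv'.trans hv.symm)
  -- The source condition puts `u'` in the column of `y`. Another box there would have a `τ'`-entry
  -- below `m`, hence by column equivalence a `τ`-entry below that of `y`, against maximality.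
  have huy : u' = y := by
    by_contra hne
    have hlt : τ'.toFun u' < τ'.toFun y := by
      rcases lt_trichotomy (τ'.toFun u') m with h1 | h1 | h1
      · omega
      · exact absurd (τ'.inj (h1.trans hy.symm)) hne
      · have := hagree u' (Or.inr h1)
        omega
    have h2 := (h u' y (by omega)).2 hlt
    have h3 := hmax y ⟨hym, le_rfl⟩
    omega
  subst huy
  have h1 := τ'.row_lt hr (by omega)
  have h2 := hagree v' (Or.inr (by omega))
  omega

theorem IsSource.eq_of_colEquiv {τ τ' : SPCT α σ} (hs : τ.IsSource) (hs' : τ'.IsSource)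
    (h : ColEquiv τ τ') : τ = τ' := by
  by_contra hne
  have hex : ∃ z, τ.toFun z ≠ τ'.toFun z := by
    by_contra hcon
    push Not at hcon
    exact hne (ext_fun (funext hcon))
  obtain ⟨z, hz⟩ := hex
  obtain ⟨x, hx, hmax⟩ := Finset.exists_max_image
    (Finset.univ.filter fun u : Box α => τ.toFun u ≠ τ'.toFun u) τ.toFun ⟨z, by simpa using hz⟩
  simp only [Finset.mem_filter, Finset.mem_univ, true_and] at hx hmax
  have hagree₁ : ∀ w, τ.toFun x < τ.toFun w → τ.toFun w = τ'.toFun w := fun w hw =>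
    not_not.1 fun h1 => (hmax w h1).not_gt hw
  -- Both tableaux use all of `1, …, n`, so agreement on the large entries of `τ` also covers those
  -- of `τ'`.
  have hagree₂ : ∀ w, τ.toFun x < τ'.toFun w → τ.toFun w = τ'.toFun w := by
    intro w hw
    obtain ⟨v, hv⟩ := τ.exists_box (τ'.toFun w) (τ'.isPCT.pos w) (τ'.le w)
    have e := hagree₁ v (by omega)
    rwa [τ'.inj (e.symm.trans hv)] at hv
  obtain ⟨y, hy⟩ := τ'.exists_box (τ.toFun x) (τ.isPCT.pos x) (τ.le x)
  rcases lt_trichotomy x.col y.col with hc | hc | hc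
  · exact hs.not_col_lt h (fun w hw => hw.elim (hagree₁ w) (hagree₂ w)) rfl hy hc
  -- In a common column, column equivalence gives `y` an entry of `τ` above `m`, where both tableaux
  -- agree; but `τ'` has `m` there.
  · have h1 : τ'.toFun x < τ'.toFun y := by
      rcases lt_trichotomy (τ'.toFun x) (τ.toFun x) with h1 | h1 | h1
      · omega
      · exact absurd h1.symm hx
      · exact absurd (hagree₂ x h1) hx
    have h2 := (h x y hc).2 h1
    have h3 := hagree₁ y h2
    omega
  · exact hs'.not_col_lt h.symm (fun w hw => (hw.elim (hagree₂ w) (hagree₁ w)).symm) hy rfl hc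

/-! ### Submodules generated by tableaux -/

theorem act_eq_pi_smul (i : Gen n) (τ τ' : SPCT α σ) (h : act i τ = Finsupp.single τ' 1) :
    (ZeroHecke.pi i • τ.vec : SMod α σ) = τ'.vec :=
  (pi_smul_vec i τ).trans h

/-- Every tableau is column equivalent to a source tableau, and lies in the submodule that it
generates. -/
theorem exists_isSource (τ : SPCT α σ) : ∃ s : SPCT α σ, s.IsSource ∧ ColEquiv s τ ∧
    τ.vec ∈ Submodule.span (ZeroHecke n) {s.vec} := by
  have hbound : ∀ t : SPCT α σ, ∑ x, x.col * t.toFun x ≤ ∑ x : Box α, x.col * n := fun t =>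
    Finset.sum_le_sum fun x _ => Nat.mul_le_mul_left _ (t.le x)
  -- The induction is on the gap between the weight and its upper bound.
  induction hN : (∑ x : Box α, x.col * n) - ∑ x, x.col * τ.toFun x using
    Nat.strong_induction_on generalizing τ with
  | _ N ih =>
  by_cases hs : τ.IsSource
  · exact ⟨τ, hs, fun _ _ _ => Iff.rfl, Submodule.mem_span_singleton_self _⟩
  · obtain ⟨i, τ', hact, hlt⟩ := τ.exists_act_eq_single hs
    have := hbound τ'
    obtain ⟨s, h1, h2, h3⟩ := ih _ (by omega) τ' rfl
    refine ⟨s, h1, h2.trans (ColEquiv.of_act (i := i) ?_), ?_⟩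
    · rw [hact]
      simp
    · rw [← act_eq_pi_smul i τ' τ hact]
      exact Submodule.smul_mem _ _ h3

/-- Complex scalars act through `H_n(0)`, so an `H_n(0)`-submodule containing every basis vector is
everything. -/
theorem algebraMap_smul_vec (c : ℂ) (τ : SPCT α σ) :
    (algebraMap ℂ (ZeroHecke n) c • τ.vec : SMod α σ) =
      (Finsupp.single τ c : SPCT α σ →₀ ℂ) := by
  change rep α σ (algebraMap ℂ (ZeroHecke n) c) (Finsupp.single τ 1) = _
  rw [AlgHom.commutes]
  simp [Module.algebraMap_end_apply]

theorem eq_top_of_vec_mem (W : Submodule (ZeroHecke n) (SMod α σ))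
    (h : ∀ τ : SPCT α σ, τ.vec ∈ W) : W = ⊤ := by
  rw [eq_top_iff]
  rintro v -
  change SPCT α σ →₀ ℂ at v
  induction v using Finsupp.induction_linear with
  | zero => exact W.zero_mem
  | add f g hf hg => exact W.add_mem hf hg
  | single τ c =>
    rw [← algebraMap_smul_vec]
    exact W.smul_mem _ (h τ)

/-- By induction on a word in the free algebra, this reduces to a single generator, where
`ColEquiv.of_act` applies. -/
theorem smul_mem_supported (τ : SPCT α σ) (a : ZeroHecke n) (v : SPCT α σ →₀ ℂ)
    (hv : v ∈ Finsupp.supported ℂ ℂ {t | ColEquiv τ t}) :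
    rep α σ a v ∈ Finsupp.supported ℂ ℂ {t | ColEquiv τ t} := by
  obtain ⟨a, rfl⟩ := RingQuot.mkAlgHom_surjective ℂ (HeckeRel n) a
  induction a using FreeAlgebra.induction generalizing v with
  | grade0 r =>
    rw [AlgHom.commutes, AlgHom.commutes, Module.algebraMap_end_apply]
    exact Submodule.smul_mem _ _ hv
  | grade1 i =>
    have e : rep α σ (RingQuot.mkAlgHom ℂ (HeckeRel n) (FreeAlgebra.ι ℂ i)) = op i := by
      simp [rep]
    rw [e, op, Finsupp.linearCombination_apply, Finsupp.sum]
    refine Submodule.sum_mem _ fun t ht => Submodule.smul_mem _ _ ?_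
    rw [Finsupp.mem_supported]
    intro t' ht'
    exact ((Finsupp.mem_supported ℂ v).1 hv ht).trans (ColEquiv.of_act ht')
  | mul a b ha hb =>
    rw [map_mul, map_mul, Module.End.mul_apply]
    exact ha _ (hb _ hv)
  | add a b ha hb =>
    rw [map_add, map_add, LinearMap.add_apply]
    exact Submodule.add_mem _ (ha _ hv) (hb _ hv)

theorem colEquiv_of_span_eq_top {τ : SPCT α σ}
    (h : Submodule.span (ZeroHecke n) {τ.vec} = ⊤) (τ' : SPCT α σ) : ColEquiv τ τ' := by
  have hmem : τ'.vec ∈ Submodule.span (ZeroHecke n) {τ.vec} := h ▸ Submodule.mem_top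
  obtain ⟨a, ha⟩ := Submodule.mem_span_singleton.1 hmem
  have hsupp := smul_mem_supported τ a (Finsupp.single τ 1)
    (Finsupp.single_mem_supported ℂ 1 (show ColEquiv τ τ from fun _ _ _ => Iff.rfl))
  change rep α σ a (Finsupp.single τ 1) = Finsupp.single τ' 1 at ha
  rw [ha, Finsupp.mem_supported] at hsupp
  exact hsupp (by simp)

/-! ### The two equivalences -/

theorem existsUnique_isSource_iff : (∃! τ : SPCT α σ, τ.IsSource) ↔ IsSimple α σ := by
  constructor
  · rintro ⟨τ, -, huniq⟩
    have : Nonempty (SPCT α σ) := ⟨τ⟩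
    refine isSimple_of_colEquiv fun t t' => ?_
    obtain ⟨s, hs, hst, -⟩ := t.exists_isSource
    obtain ⟨s', hs', hst', -⟩ := t'.exists_isSource
    rw [huniq s hs] at hst
    rw [huniq s' hs'] at hst'
    exact hst.symm.trans hst'
  · intro h
    obtain ⟨τ, -⟩ := exists_rowFilling h.1
    obtain ⟨s, hs, -, -⟩ := τ.exists_isSource
    exact ⟨s, hs, fun s' hs' => hs'.eq_of_colEquiv hs (colEquiv_of_isSimple h _ _)⟩

end SPCT

theorem isSPCTCyclic_iff {n : ℕ} (α : Composition n) (σ : Equiv.Perm (Fin α.length)) :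
    IsSPCTCyclic α σ ↔ IsSimple α σ := by
  constructor
  · rintro ⟨τ, hτ⟩
    have : Nonempty (SPCT α σ) := ⟨τ⟩
    exact SPCT.isSimple_of_colEquiv fun t t' =>
      (SPCT.colEquiv_of_span_eq_top hτ t).symm.trans (SPCT.colEquiv_of_span_eq_top hτ t')
  · intro h
    obtain ⟨s, hs, huniq⟩ := SPCT.existsUnique_isSource_iff.2 h
    refine ⟨s, SPCT.eq_top_of_vec_mem _ fun τ => ?_⟩
    obtain ⟨s', hs', -, hmem⟩ := τ.exists_isSource
    rwa [huniq s' hs'] at hmem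

end PermComp

theorem theorem3p9 (n : ℕ) (α : Composition n) :
    (∀ σ : Equiv.Perm (Fin α.length),
      (∃! τ : PermComp.SPCT α σ, τ.IsSource) ↔ PermComp.IsSimple α σ) ∧
    (∀ σ : Equiv.Perm (Fin α.length),
      PermComp.IsSPCTCyclic α σ ↔ PermComp.IsSimple α σ) :=
  ⟨fun _ => PermComp.SPCT.existsUnique_isSource_iff, fun σ => PermComp.isSPCTCyclic_iff α σ⟩
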